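/- **Theorem (Hausdorff–Young–Paley inequality).** Let $1 < p \le 2$, let $p'$ be the conjugate exponent, $\frac1p + \frac1{p'} = 1$, and let $p \le b \le p'$. There is a constant $C > 0$ depending only on $p$ and $b$ such that the following holds for every $d$. Let $L$ be a lattice in $\mathbb{R}^d$ (a discrete subgroup spanned over $\mathbb{Z}$ by $d$ linearly independent vectors), let $L^\perp = \{\kappa \in \mathbb{R}^d : \kappa\cdot\lambda \in \mathbb{Z} \text{ for all } \lambda \in L\}$ be its dual lattice, and let $\Omega \subseteq \mathbb{R}^d$ be a fundamental domain of $L$, i.e. a Lebesgue measurable set that contains exactly one representative of every coset of $\mathbb{R}^d/L$. Let $\varphi : L^\perp \to (0,\infty)$ satisfy $$M_\varphi := \sup_{s>0}\, s\cdot \#\{\kappa \in L^\perp : \varphi(\kappa) \ge s\} < \infty .$$ Then for every $f \in L^p(\Omega)$ $$\Bigl(\sum_{\kappa\in L^\perp} \bigl|\widehat f(\kappa)\,\varphi(\kappa)^{\frac1b-\frac1{p'}}\bigr|^b\Bigr)^{1/b} \le C\, M_\varphi^{\frac1b-\frac1{p'}}\, \|f\|_{L^p(\Omega)},$$ where $$\widehat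 f(\kappa) = \frac1{|\Omega|}\int_\Omega f(x)\,e^{-2\pi i\kappa\cdot x}\,dx, \qquad \|f\|_{L^p(\Omega)} = \Bigl(\frac1{|\Omega|}\int_\Omega |f(x)|^p\,dx\Bigr)^{1/p}$$ and $|\Omega|$ is the Lebesgue measure of $\Omega$. -/

import Mathlib

open MeasureTheory
open scoped ENNReal NNReal InnerProductSpace

noncomputable section

namespace LatticeFourier

variable {d : ℕ}

/-- The dual lattice `L^⊥ = {κ ∈ ℝ^d | κ · l ∈ ℤ for all l ∈ L}`: Mathlib's dual submodule over `ℤ`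
for the Euclidean inner product. -/
def dualLattice (L : Submodule ℤ (EuclideanSpace ℝ (Fin d))) :
    Submodule ℤ (EuclideanSpace ℝ (Fin d)) :=
  LinearMap.BilinForm.dualSubmodule (innerₗ (EuclideanSpace ℝ (Fin d))) L

theorem mem_dualLattice {L : Submodule ℤ (EuclideanSpace ℝ (Fin d))}
    {κ : EuclideanSpace ℝ (Fin d)} :
    κ ∈ dualLattice L ↔ ∀ l ∈ L, ∃ n : ℤ, (n : ℝ) = ⟪κ, l⟫_ℝ := by
  simp [dualLattice, LinearMap.BilinForm.mem_dualSubmodule, Submodule.mem_one]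

/-- `Ω` is a fundamental domain of `L`: it is Lebesgue measurable, and every `x ∈ ℝ^d` has exactly
one translate by an element of `L` in `Ω`, that is, `∑_{l ∈ L} 1_Ω(x + l) = 1`. -/
structure IsLatticeFundamentalDomain (L : Submodule ℤ (EuclideanSpace ℝ (Fin d)))
    (Ω : Set (EuclideanSpace ℝ (Fin d))) : Prop where
  measurable : NullMeasurableSet Ω volume
  existsUnique_add_mem : ∀ x : EuclideanSpace ℝ (Fin d), ∃! l : L, x + (l : EuclideanSpace ℝ (Fin d)) ∈ Ω

/-- The Fourier coefficient `f̂(κ) = |Ω|⁻¹ ∫_Ω f(x) e^{-2πi κ·x} dx`. -/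
def coeff (Ω : Set (EuclideanSpace ℝ (Fin d))) (f : EuclideanSpace ℝ (Fin d) → ℂ)
    (κ : EuclideanSpace ℝ (Fin d)) : ℂ :=
  ((volume.real Ω : ℝ) : ℂ)⁻¹ *
    ∫ x in Ω, f x * Complex.exp (-2 * Real.pi * Complex.I * ((⟪κ, x⟫_ℝ : ℝ) : ℂ))

/-- The `L^p(Ω)` norm `(|Ω|⁻¹ ∫_Ω |f|^p dx)^{1/p}` with respect to normalized Lebesgue measure
on `Ω`. -/
def normLp (Ω : Set (EuclideanSpace ℝ (Fin d))) (p : ℝ) (f : EuclideanSpace ℝ (Fin d) → ℂ) :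
    ℝ≥0∞ :=
  eLpNorm f (ENNReal.ofReal p) ((volume Ω)⁻¹ • volume.restrict Ω)

/-- `M_φ = sup_{s > 0} s · #{κ | φ(κ) ≥ s}`, as an extended nonnegative number. -/
def levelSup {α : Type*} (φ : α → ℝ) : ℝ≥0∞ :=
  ⨆ (s : ℝ) (_ : 0 < s), ENNReal.ofReal s * (({κ | s ≤ φ κ}.encard : ℕ∞) : ℝ≥0∞)

end LatticeFourier

end

/-! Only two facts about Fourier coefficients matter: |f̂(κ)| ≤ ‖f‖₁, and Bessel's inequality on L².
`IsBesselMap` isolates them together with additivity. The case b = p (Paley) is Marcinkiewicz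
interpolation: for the weight φ² on the index set, f ↦ Tf/φ is of weak types (1,1) and (2,2), the
former because ∑_{φ ≤ r} φ² ≤ 2Mr (`setLIntegral_sq_le_of_level_bound`). Cutting f at a height
proportional to the level gives `IsBesselMap.withDensity_level_le`, and integrating over levels
gives `IsBesselMap.paley`.

The case b = p' (Hausdorff–Young) is deduced from Paley, at the price of a constant: take φ(κ) to be
the inverse rank of |Tf(κ)| in decreasing order, for which M = 1 is admissible, and apply
`sum_rpow_le_of_sum_rank_le`. Hölder's inequality between the two endpoints gives every b in
between. On the lattice, Bessel's inequality comes from the orthonormality of the exponentials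
e^{2πiκ·x}, κ ∈ L^⊥, on Ω. -/

/-- A map from functions to families of numbers that is additive on `L¹`, bounded by the `L¹` norm,
and satisfies Bessel's inequality on `L²`. -/
structure IsBesselMap {X ι : Type*} [MeasurableSpace X] (μ : Measure X) (T : (X → ℂ) → ι → ℂ) :
    Prop where
  map_add : ∀ g h, Integrable g μ → Integrable h μ → ∀ κ, T (g + h) κ = T g κ + T h κ
  enorm_le : ∀ g, Integrable g μ → ∀ κ, ‖T g κ‖ₑ ≤ ∫⁻ x, ‖g x‖ₑ ∂μ
  tsum_sq_le : ∀ h, MemLp h 2 μ → ∑' κ, ‖T h κ‖ₑ ^ 2 ≤ ∫⁻ x, ‖h x‖ₑ ^ 2 ∂μ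

/-! ### Sums of φ² over sublevel sets -/

section Levels

variable {ι : Type*} [MeasurableSpace ι] [DiscreteMeasurableSpace ι]

/-- Layer cake: the sum is 2∫ t · #{t ≤ φ ≤ r} dt over t > 0, whose integrand is at most M for t ≤ r
and zero beyond. Paley's inequality uses the level bound on φ only through this estimate. -/
theorem setLIntegral_sq_le_of_level_bound {φ : ι → ℝ} (hφ : ∀ κ, 0 < φ κ) {M : ℝ} (hM : 0 < M)
    (hlev : ∀ s : ℝ, 0 < s → ENNReal.ofReal s * Measure.count {κ | s ≤ φ κ} ≤ ENNReal.ofReal M)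
    (r : ℝ) :
    ∫⁻ κ in {κ | φ κ ≤ r}, ENNReal.ofReal (φ κ ^ 2) ∂Measure.count ≤ ENNReal.ofReal (2 * M * r) := by
  have hcake := lintegral_rpow_eq_lintegral_meas_le_mul
    ((Measure.count : Measure ι).restrict {κ | φ κ ≤ r}) (f := φ)
    (Filter.Eventually.of_forall fun κ => (hφ κ).le) Measurable.of_discrete.aemeasurable
    (p := 2) two_pos
  simp only [Real.rpow_ofNat] at hcake
  rw [hcake]
  have hpt : ∀ t ∈ Set.Ioi (0 : ℝ),
      (Measure.count : Measure ι).restrict {κ | φ κ ≤ r} {κ | t ≤ φ κ} *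
        ENNReal.ofReal (t ^ ((2 : ℝ) - 1)) ≤
      (Set.Iic r).indicator (fun _ => ENNReal.ofReal M) t := by
    intro t ht
    rw [Measure.restrict_apply (MeasurableSet.of_discrete)]
    by_cases h : t ≤ r
    · rw [Set.indicator_of_mem (by exact h)]
      refine le_trans ?_ (hlev t ht)
      rw [mul_comm]
      norm_num
      gcongr
      exact Set.inter_subset_left
    · have : {κ | t ≤ φ κ} ∩ {κ | φ κ ≤ r} = ∅ := by
        ext κ
        simp only [Set.mem_inter_iff, Set.mem_ofPred_eq, Set.mem_empty_iff_false, iff_false, not_and]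
        intro h1 h2
        exact h (h1.trans h2)
      simp [this]
  calc _ ≤ ENNReal.ofReal 2 * ∫⁻ t in Set.Ioi (0 : ℝ),
        (Set.Iic r).indicator (fun _ => ENNReal.ofReal M) t := by
        gcongr 1
        exact setLIntegral_mono' measurableSet_Ioi hpt
    _ = ENNReal.ofReal (2 * M * r) := by
        rw [setLIntegral_indicator measurableSet_Iic, setLIntegral_const, Set.inter_comm,
          Set.Ioi_inter_Iic, Real.volume_Ioc, sub_zero, ← ENNReal.ofReal_mul hM.le,
          ← ENNReal.ofReal_mul two_pos.le, mul_assoc]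

end Levels

/-! ### Power integrals in the level variable -/

theorem lintegral_indicator_Iio_rpow {q c : ℝ} (hq : 0 < q) (hc : 0 ≤ c) :
    ∫⁻ t in Set.Ioi (0 : ℝ), (Set.Iio c).indicator (fun t => ENNReal.ofReal (t ^ (q - 1))) t =
      ENNReal.ofReal (c ^ q / q) := by
  rw [setLIntegral_indicator measurableSet_Iio, Set.inter_comm, Set.Ioi_inter_Iio,
    setLIntegral_congr (Ioo_ae_eq_Ioc (μ := volume)), ← ofReal_integral_eq_lintegral_ofReal]
  · rw [← intervalIntegral.integral_of_le hc, integral_rpow (Or.inl (by linarith))]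
    simp [Real.zero_rpow hq.ne']
  · exact (intervalIntegral.intervalIntegrable_rpow' (by linarith)).1
  · filter_upwards [ae_restrict_mem measurableSet_Ioc] with t ht
    exact Real.rpow_nonneg ht.1.le _

theorem lintegral_indicator_Ici_rpow {p c : ℝ} (hp : p < 2) (hc : 0 < c) :
    ∫⁻ t in Set.Ioi (0 : ℝ), (Set.Ici c).indicator (fun t => ENNReal.ofReal (t ^ (p - 3))) t =
      ENNReal.ofReal (c ^ (p - 2) / (2 - p)) := by
  have : Set.Ici c ∩ Set.Ioi 0 = Set.Ici c :=
    Set.inter_eq_left.2 fun t ht => lt_of_lt_of_le hc ht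
  rw [setLIntegral_indicator measurableSet_Ici, this,
    setLIntegral_congr (Ioi_ae_eq_Ici (μ := volume)).symm, ← ofReal_integral_eq_lintegral_ofReal]
  · rw [integral_Ioi_rpow_of_lt (by linarith) hc, show p - 3 + 1 = -(2 - p) by ring, neg_div_neg_eq]
    congr 3
    ring
  · exact integrableOn_Ioi_rpow_of_lt (by linarith) hc
  · filter_upwards [ae_restrict_mem measurableSet_Ioi] with t ht
    exact Real.rpow_nonneg (hc.trans ht).le _

/-! ### Paley's inequality by real interpolation -/

section Marcinkiewicz

variable {X ι : Type*} [MeasurableSpace X] {μ : Measure X} [IsFiniteMeasure μ]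
  {T : (X → ℂ) → ι → ℂ} [MeasurableSpace ι] [DiscreteMeasurableSpace ι]

/-- Split f at height s into a large part g and a bounded part h. The L¹ bound controls Tg
uniformly, so where it is responsible for a large quotient φ must be small; Chebyshev and Bessel
handle Th. -/
theorem IsBesselMap.withDensity_level_le (hT : IsBesselMap μ T) {φ : ι → ℝ} (hφ : ∀ κ, 0 < φ κ)
    {M : ℝ} (hM : 0 < M)
    (hlev : ∀ s : ℝ, 0 < s → ENNReal.ofReal s * Measure.count {κ | s ≤ φ κ} ≤ ENNReal.ofReal M)
    {f : X → ℂ} (hfm : StronglyMeasurable f) (hf : Integrable f μ) {t : ℝ} (ht : 0 < t) (s : ℝ) :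
    (Measure.count : Measure ι).withDensity (fun κ => ENNReal.ofReal (φ κ ^ 2))
        {κ | t ≤ ‖T f κ‖ / φ κ} ≤
      ENNReal.ofReal (4 * M / t) * ∫⁻ x, {x | s < ‖f x‖}.indicator (fun x => ‖f x‖ₑ) x ∂μ +
      ENNReal.ofReal (4 / t ^ 2) * ∫⁻ x, {x | ‖f x‖ ≤ s}.indicator (fun x => ‖f x‖ₑ ^ 2) x ∂μ := by
  have hS : MeasurableSet {x | s < ‖f x‖} := measurableSet_lt measurable_const hfm.norm.measurable
  have hS' : MeasurableSet {x | ‖f x‖ ≤ s} := measurableSet_le hfm.norm.measurable measurable_const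
  set g := {x | s < ‖f x‖}.indicator f with hg
  set h := {x | ‖f x‖ ≤ s}.indicator f with hh
  have hgi : Integrable g μ := hf.indicator hS
  have hhi : Integrable h μ := hf.indicator hS'
  have hgh : f = g + h := by
    ext x
    by_cases hx : s < ‖f x‖
    · simp [hg, hh, hx]
    · simp [hg, hh, hx, not_lt.1 hx]
  have hh2 : MemLp h 2 μ := by
    refine MemLp.of_bound (hfm.indicator hS').aestronglyMeasurable |s| (Filter.Eventually.of_forall ?_)
    intro x
    by_cases hx : ‖f x‖ ≤ s
    · simpa [hh, hx] using hx.trans (le_abs_self s)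
    · simp [hh, hx]
  have hgn : ∫⁻ x, {x | s < ‖f x‖}.indicator (fun x => ‖f x‖ₑ) x ∂μ = ∫⁻ x, ‖g x‖ₑ ∂μ := by
    simp only [hg, enorm_indicator_eq_indicator_enorm]
  have hhn : ∫⁻ x, {x | ‖f x‖ ≤ s}.indicator (fun x => ‖f x‖ₑ ^ 2) x ∂μ = ∫⁻ x, ‖h x‖ₑ ^ 2 ∂μ := by
    congr 1 with x
    by_cases hx : ‖f x‖ ≤ s <;> simp [hh, hx]
  rw [hgn, hhn]
  set A := ∫⁻ x, ‖g x‖ₑ ∂μ with hA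
  have hAfin : A ≠ ∞ := hgi.2.ne
  -- Chosen so that φ κ > r forces ‖T g κ‖ ≤ A < tφ(κ)/2.
  set r := 2 * A.toReal / t with hr
  have hsub : {κ | t ≤ ‖T f κ‖ / φ κ} ⊆ {κ | φ κ ≤ r} ∪ {κ | t / 2 * φ κ ≤ ‖T h κ‖} := by
    intro κ hκ
    simp only [Set.mem_ofPred_eq, le_div_iff₀ (hφ κ)] at hκ
    by_contra hcon
    simp only [Set.mem_union, Set.mem_ofPred_eq, not_or, not_le] at hcon
    have h1 : ‖T g κ‖ ≤ A.toReal := by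
      rw [← toReal_enorm]
      exact ENNReal.toReal_mono hAfin (hT.enorm_le g hgi κ)
    have h2 : ‖T f κ‖ ≤ ‖T g κ‖ + ‖T h κ‖ := by
      conv_lhs => rw [hgh, hT.map_add g h hgi hhi κ]
      exact norm_add_le _ _
    have h3 := hcon.1
    rw [hr, div_lt_iff₀ ht] at h3
    linarith [hcon.2]
  refine (measure_mono hsub).trans ((measure_union_le _ _).trans (add_le_add ?_ ?_))
  · rw [withDensity_apply _ MeasurableSet.of_discrete]
    refine (setLIntegral_sq_le_of_level_bound hφ hM hlev r).trans ?_
    rw [← ENNReal.ofReal_toReal hAfin, ← ENNReal.ofReal_mul (by positivity)]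
    apply le_of_eq
    congr 1
    rw [hr]
    ring
  · rw [withDensity_apply _ MeasurableSet.of_discrete]
    calc _ ≤ ∫⁻ κ in {κ | t / 2 * φ κ ≤ ‖T h κ‖}, ENNReal.ofReal (4 / t ^ 2) * ‖T h κ‖ₑ ^ 2
          ∂Measure.count := by
          refine setLIntegral_mono' MeasurableSet.of_discrete fun κ hκ => ?_
          rw [← ofReal_norm, ← ENNReal.ofReal_pow (norm_nonneg _),
            ← ENNReal.ofReal_mul (by positivity)]
          apply ENNReal.ofReal_le_ofReal
          have h1 : φ κ ≤ 2 / t * ‖T h κ‖ := by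
            have h2 : t / 2 * φ κ ≤ ‖T h κ‖ := hκ
            calc φ κ = 2 / t * (t / 2 * φ κ) := by field_simp
              _ ≤ _ := by gcongr
          calc φ κ ^ 2 ≤ (2 / t * ‖T h κ‖) ^ 2 := by
                have := (hφ κ).le
                gcongr
            _ = _ := by ring
      _ ≤ ∫⁻ κ, ENNReal.ofReal (4 / t ^ 2) * ‖T h κ‖ₑ ^ 2 ∂Measure.count :=
          setLIntegral_le_lintegral _ _
      _ = ENNReal.ofReal (4 / t ^ 2) * ∑' κ, ‖T h κ‖ₑ ^ 2 := by
          rw [lintegral_count, ENNReal.tsum_mul_left]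
      _ ≤ _ := by
          gcongr
          exact hT.tsum_sq_le h hh2

/-- The constant in Paley's inequality. -/
noncomputable def paleyConst (p : ℝ) : ℝ := 4 * p / (p - 1) + 4 * p / (2 - p)

/-- Covers p = 2 as well: there 4p/(2 - p) is a division by zero, hence 0, and the first summand
suffices. -/
theorem one_le_paleyConst {p : ℝ} (hp : 1 < p) (hp2 : p ≤ 2) : 1 ≤ paleyConst p := by
  have h1 : 0 < p - 1 := by linarith
  have h2 : 0 ≤ 4 * p / (2 - p) := div_nonneg (by linarith) (by linarith)
  have h3 : 1 ≤ 4 * p / (p - 1) := by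
    rw [le_div_iff₀ h1]
    linarith
  unfold paleyConst
  linarith

/-- Tonelli: for fixed x the level integral is that of t^(p-2) over t < |f x|/M, convergent at 0
because p > 1. -/
theorem lintegral_lintegral_rpow_high {f : X → ℂ} (hfm : StronglyMeasurable f) {p M : ℝ}
    (hp : 1 < p) (hM : 0 < M) :
    ∫⁻ t in Set.Ioi (0 : ℝ), ENNReal.ofReal (t ^ (p - 1)) * (ENNReal.ofReal (4 * M / t) *
        ∫⁻ x, {x | M * t < ‖f x‖}.indicator (fun x => ‖f x‖ₑ) x ∂μ) =
      ENNReal.ofReal (4 / (p - 1) * M ^ (2 - p)) * ∫⁻ x, ‖f x‖ₑ ^ p ∂μ := by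
  have hmeas : Measurable (Function.uncurry fun (t : ℝ) (x : X) =>
      ENNReal.ofReal (t ^ (p - 2)) * {x | M * t < ‖f x‖}.indicator (fun x => ‖f x‖ₑ) x) := by
    have h1 : MeasurableSet {z : ℝ × X | M * z.1 < ‖f z.2‖} :=
      measurableSet_lt (by fun_prop) (hfm.norm.measurable.comp measurable_snd)
    refine Measurable.mul (by fun_prop) ?_
    exact (hfm.enorm.comp measurable_snd).indicator h1
  calc _ = ∫⁻ t in Set.Ioi (0 : ℝ), ENNReal.ofReal (4 * M) * ∫⁻ x, ENNReal.ofReal (t ^ (p - 2)) *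
          {x | M * t < ‖f x‖}.indicator (fun x => ‖f x‖ₑ) x ∂μ := by
        refine setLIntegral_congr_fun measurableSet_Ioi fun t ht => ?_
        have ht' : (0 : ℝ) < t := ht
        rw [lintegral_const_mul' _ _ ENNReal.ofReal_ne_top, ← mul_assoc, ← mul_assoc,
          ← ENNReal.ofReal_mul (by positivity), ← ENNReal.ofReal_mul (by positivity)]
        congr 2
        rw [show p - 1 = (p - 2) + 1 by ring, Real.rpow_add ht', Real.rpow_one]
        field_simp
    _ = ENNReal.ofReal (4 * M) * ∫⁻ x, (∫⁻ t in Set.Ioi (0 : ℝ), ENNReal.ofReal (t ^ (p - 2)) *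
          {x | M * t < ‖f x‖}.indicator (fun x => ‖f x‖ₑ) x) ∂μ := by
        rw [lintegral_const_mul' _ _ ENNReal.ofReal_ne_top, lintegral_lintegral_swap hmeas.aemeasurable]
    _ = ENNReal.ofReal (4 * M) * ∫⁻ x, ENNReal.ofReal (M ^ (1 - p) / (p - 1)) * ‖f x‖ₑ ^ p ∂μ := by
        congr 2 with x
        have h1 : ∀ t : ℝ, ENNReal.ofReal (t ^ (p - 2)) *
            {x | M * t < ‖f x‖}.indicator (fun x => ‖f x‖ₑ) x =
            (Set.Iio (‖f x‖ / M)).indicator (fun t => ENNReal.ofReal (t ^ (p - 1 - 1))) t * ‖f x‖ₑ := by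
          intro t
          by_cases h : M * t < ‖f x‖
          · have h' : t < ‖f x‖ / M := by rwa [lt_div_iff₀ hM, mul_comm]
            rw [Set.indicator_of_mem (by exact h), Set.indicator_of_mem (by exact h')]
            ring_nf
          · have h' : ¬ t < ‖f x‖ / M := by rwa [lt_div_iff₀ hM, mul_comm]
            rw [Set.indicator_of_notMem (by exact h), Set.indicator_of_notMem (by exact h')]
            simp
        simp_rw [h1]
        rw [lintegral_mul_const' _ _ enorm_ne_top, lintegral_indicator_Iio_rpow (by linarith) (by positivity),
          ← ofReal_norm, ENNReal.ofReal_rpow_of_nonneg (norm_nonneg _) (by linarith),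
          ← ENNReal.ofReal_mul (div_nonneg (by positivity) (by linarith)),
          ← ENNReal.ofReal_mul (div_nonneg (by positivity) (by linarith))]
        congr 1
        rw [Real.div_rpow (norm_nonneg _) hM.le, show 1 - p = -(p - 1) by ring, Real.rpow_neg hM.le]
        rcases (norm_nonneg (f x)).eq_or_lt with h0 | h0
        · rw [← h0, Real.zero_rpow (by linarith), Real.zero_rpow (by linarith)]
          simp
        · conv_rhs => rw [show p = (p - 1) + 1 by ring, Real.rpow_add h0, Real.rpow_one]
          ring_nf
    _ = _ := by
        rw [lintegral_const_mul' _ _ ENNReal.ofReal_ne_top, ← mul_assoc,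
          ← ENNReal.ofReal_mul (by positivity)]
        congr 2
        rw [show 2 - p = 1 + (1 - p) by ring, Real.rpow_add hM, Real.rpow_one]
        ring

/-- Tonelli again, now with t^(p-3) over t ≥ |f x|/M, convergent at infinity because p < 2. -/
theorem lintegral_lintegral_rpow_low {f : X → ℂ} (hfm : StronglyMeasurable f) {p M : ℝ}
    (hp : 1 < p) (hp2 : p < 2) (hM : 0 < M) :
    ∫⁻ t in Set.Ioi (0 : ℝ), ENNReal.ofReal (t ^ (p - 1)) * (ENNReal.ofReal (4 / t ^ 2) *
        ∫⁻ x, {x | ‖f x‖ ≤ M * t}.indicator (fun x => ‖f x‖ₑ ^ 2) x ∂μ) =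
      ENNReal.ofReal (4 / (2 - p) * M ^ (2 - p)) * ∫⁻ x, ‖f x‖ₑ ^ p ∂μ := by
  have hmeas : Measurable (Function.uncurry fun (t : ℝ) (x : X) =>
      ENNReal.ofReal (t ^ (p - 3)) * {x | ‖f x‖ ≤ M * t}.indicator (fun x => ‖f x‖ₑ ^ 2) x) := by
    have h1 : MeasurableSet {z : ℝ × X | ‖f z.2‖ ≤ M * z.1} :=
      measurableSet_le (hfm.norm.measurable.comp measurable_snd) (by fun_prop)
    refine Measurable.mul (by fun_prop) ?_
    exact ((hfm.enorm.pow_const 2).comp measurable_snd).indicator h1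
  calc _ = ∫⁻ t in Set.Ioi (0 : ℝ), ENNReal.ofReal 4 * ∫⁻ x, ENNReal.ofReal (t ^ (p - 3)) *
          {x | ‖f x‖ ≤ M * t}.indicator (fun x => ‖f x‖ₑ ^ 2) x ∂μ := by
        refine setLIntegral_congr_fun measurableSet_Ioi fun t ht => ?_
        have ht' : (0 : ℝ) < t := ht
        rw [lintegral_const_mul' _ _ ENNReal.ofReal_ne_top, ← mul_assoc, ← mul_assoc,
          ← ENNReal.ofReal_mul (by positivity), ← ENNReal.ofReal_mul (by positivity)]
        congr 2
        rw [show p - 1 = (p - 3) + 2 by ring, Real.rpow_add ht', Real.rpow_ofNat]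
        field_simp
    _ = ENNReal.ofReal 4 * ∫⁻ x, (∫⁻ t in Set.Ioi (0 : ℝ), ENNReal.ofReal (t ^ (p - 3)) *
          {x | ‖f x‖ ≤ M * t}.indicator (fun x => ‖f x‖ₑ ^ 2) x) ∂μ := by
        rw [lintegral_const_mul' _ _ ENNReal.ofReal_ne_top, lintegral_lintegral_swap hmeas.aemeasurable]
    _ = ENNReal.ofReal 4 * ∫⁻ x, ENNReal.ofReal (M ^ (2 - p) / (2 - p)) * ‖f x‖ₑ ^ p ∂μ := by
        congr 2 with x
        have h1 : ∀ t : ℝ, ENNReal.ofReal (t ^ (p - 3)) *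
            {x | ‖f x‖ ≤ M * t}.indicator (fun x => ‖f x‖ₑ ^ 2) x =
            (Set.Ici (‖f x‖ / M)).indicator (fun t => ENNReal.ofReal (t ^ (p - 3))) t * ‖f x‖ₑ ^ 2 := by
          intro t
          by_cases h : ‖f x‖ ≤ M * t
          · have h' : ‖f x‖ / M ≤ t := by rwa [div_le_iff₀ hM, mul_comm]
            rw [Set.indicator_of_mem (by exact h), Set.indicator_of_mem (by exact h')]
          · have h' : ¬ ‖f x‖ / M ≤ t := by rwa [div_le_iff₀ hM, mul_comm]
            rw [Set.indicator_of_notMem (by exact h), Set.indicator_of_notMem (by exact h')]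
            simp
        simp_rw [h1]
        rw [lintegral_mul_const' _ _ (by finiteness)]
        -- If f x = 0 the level integral diverges at 0, but its factor ‖f x‖ₑ ^ 2 vanishes and ∞ · 0
        -- = 0.
        rcases (norm_nonneg (f x)).eq_or_lt with h0 | h0
        · have : f x = 0 := norm_eq_zero.1 h0.symm
          simp [this, show 0 < p by linarith]
        rw [lintegral_indicator_Ici_rpow hp2 (by positivity),
          ← ofReal_norm, ENNReal.ofReal_rpow_of_nonneg (norm_nonneg _) (by linarith),
          ← ENNReal.ofReal_pow (norm_nonneg _),
          ← ENNReal.ofReal_mul (div_nonneg (by positivity) (by linarith)),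
          ← ENNReal.ofReal_mul (div_nonneg (by positivity) (by linarith))]
        congr 1
        rw [Real.div_rpow (norm_nonneg _) hM.le, show 2 - p = -(p - 2) by ring, Real.rpow_neg hM.le]
        conv_rhs => rw [show p = (p - 2) + 2 by ring, Real.rpow_add h0, Real.rpow_ofNat]
        ring_nf
    _ = _ := by
        rw [lintegral_const_mul' _ _ ENNReal.ofReal_ne_top, ← mul_assoc,
          ← ENNReal.ofReal_mul (by positivity)]
        congr 2
        ring

/-- **Paley's inequality**, for strongly measurable functions. -/
theorem IsBesselMap.paley_of_stronglyMeasurable (hT : IsBesselMap μ T) {φ : ι → ℝ}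
    (hφ : ∀ κ, 0 < φ κ) {M : ℝ} (hM : 0 < M)
    (hlev : ∀ s : ℝ, 0 < s → ENNReal.ofReal s * Measure.count {κ | s ≤ φ κ} ≤ ENNReal.ofReal M)
    {p : ℝ} (hp : 1 < p) (hp2 : p < 2) {f : X → ℂ} (hfm : StronglyMeasurable f)
    (hf : Integrable f μ) :
    ∑' κ, ENNReal.ofReal (φ κ ^ (2 - p)) * ‖T f κ‖ₑ ^ p ≤
      ENNReal.ofReal (paleyConst p * M ^ (2 - p)) * ∫⁻ x, ‖f x‖ₑ ^ p ∂μ := by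
  set ν := (Measure.count : Measure ι).withDensity (fun κ => ENNReal.ofReal (φ κ ^ 2)) with hν
  have hsum : ∑' κ, ENNReal.ofReal (φ κ ^ (2 - p)) * ‖T f κ‖ₑ ^ p =
      ∫⁻ κ, ENNReal.ofReal ((‖T f κ‖ / φ κ) ^ p) ∂ν := by
    rw [hν, lintegral_withDensity_eq_lintegral_mul _ Measurable.of_discrete Measurable.of_discrete,
      lintegral_count]
    congr 1 with κ
    have h0 := hφ κ
    rw [Pi.mul_apply, ← ofReal_norm, ENNReal.ofReal_rpow_of_nonneg (norm_nonneg _) (by linarith),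
      ← ENNReal.ofReal_mul (by positivity), ← ENNReal.ofReal_mul (by positivity),
      Real.div_rpow (norm_nonneg _) h0.le, Real.rpow_sub h0, Real.rpow_ofNat]
    ring_nf
  rw [hsum, lintegral_rpow_eq_lintegral_meas_le_mul ν
    (Filter.Eventually.of_forall fun κ => div_nonneg (norm_nonneg _) (hφ κ).le)
    Measurable.of_discrete.aemeasurable (by linarith)]
  -- The cutting height is s = M t, which makes both parts scale as M^(2-p).
  have hmono : ∫⁻ t in Set.Ioi (0 : ℝ), ν {κ | t ≤ ‖T f κ‖ / φ κ} * ENNReal.ofReal (t ^ (p - 1)) ≤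
      ∫⁻ t in Set.Ioi (0 : ℝ), (ENNReal.ofReal (t ^ (p - 1)) * (ENNReal.ofReal (4 * M / t) *
        ∫⁻ x, {x | M * t < ‖f x‖}.indicator (fun x => ‖f x‖ₑ) x ∂μ) +
        ENNReal.ofReal (t ^ (p - 1)) * (ENNReal.ofReal (4 / t ^ 2) *
        ∫⁻ x, {x | ‖f x‖ ≤ M * t}.indicator (fun x => ‖f x‖ₑ ^ 2) x ∂μ)) := by
    refine setLIntegral_mono' measurableSet_Ioi fun t ht => ?_
    rw [← mul_add, mul_comm]
    gcongr
    exact hT.withDensity_level_le hφ hM hlev hfm hf ht _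
  have hmeas : Measurable fun t : ℝ => ENNReal.ofReal (t ^ (p - 1)) * (ENNReal.ofReal (4 * M / t) *
        ∫⁻ x, {x | M * t < ‖f x‖}.indicator (fun x => ‖f x‖ₑ) x ∂μ) := by
    have h1 : MeasurableSet {z : ℝ × X | M * z.1 < ‖f z.2‖} :=
      measurableSet_lt (by fun_prop) (hfm.norm.measurable.comp measurable_snd)
    have h2 : Measurable fun z : ℝ × X => {x | M * z.1 < ‖f x‖}.indicator (fun x => ‖f x‖ₑ) z.2 :=
      (hfm.enorm.comp measurable_snd).indicator h1
    have h3 := h2.lintegral_prod_right' (ν := μ)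
    exact Measurable.mul (by fun_prop) (Measurable.mul (by fun_prop) h3)
  have hp1 : 0 < p - 1 := by linarith
  have hp2' : 0 < 2 - p := by linarith
  refine (mul_le_mul_right hmono _).trans_eq ?_
  rw [lintegral_add_left hmeas, lintegral_lintegral_rpow_high hfm hp hM,
    lintegral_lintegral_rpow_low hfm hp hp2 hM, ← add_mul,
    ← ENNReal.ofReal_add (by positivity) (by positivity), ← mul_assoc,
    ← ENNReal.ofReal_mul (by linarith)]
  congr 2
  unfold paleyConst
  ring

end Marcinkiewicz

/-! ### Hausdorff–Young and the intermediate exponents -/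

section Interpolation

variable {X ι : Type*} [MeasurableSpace X] {μ : Measure X} {T : (X → ℂ) → ι → ℂ}

/-- The difference f - g has L¹ norm zero, so T kills it. This allows passing to a strongly
measurable representative. -/
theorem IsBesselMap.congr_ae (hT : IsBesselMap μ T) {f g : X → ℂ} (hf : Integrable f μ)
    (hfg : f =ᵐ[μ] g) (κ : ι) : T f κ = T g κ := by
  have hg : Integrable g μ := hf.congr hfg
  have h0 : T (f - g) κ = 0 := by
    have h1 := hT.enorm_le (f - g) (hf.sub hg) κ
    have h2 : ∫⁻ x, ‖(f - g) x‖ₑ ∂μ = 0 := by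
      rw [lintegral_eq_zero_iff' (hf.sub hg).aestronglyMeasurable.enorm]
      filter_upwards [hfg] with x hx
      simp [hx]
    rw [h2] at h1
    simpa using h1
  have := hT.map_add g (f - g) hg (hf.sub hg) κ
  rwa [add_sub_cancel, h0, add_zero] at this

theorem IsBesselMap.comp {ι' : Type*} (hT : IsBesselMap μ T) {j : ι' → ι}
    (hj : Function.Injective j) : IsBesselMap μ (fun f κ => T f (j κ)) where
  map_add g h hg hh κ := hT.map_add g h hg hh (j κ)
  enorm_le g hg κ := hT.enorm_le g hg (j κ)
  tsum_sq_le h hh := (ENNReal.tsum_comp_le_tsum_of_injective hj fun κ => ‖T h κ‖ₑ ^ 2).trans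
    (hT.tsum_sq_le h hh)

variable [IsFiniteMeasure μ]

/-- **Paley's inequality**. -/
theorem IsBesselMap.paley (hT : IsBesselMap μ T) {φ : ι → ℝ}
    (hφ : ∀ κ, 0 < φ κ) {M : ℝ} (hM : 0 < M)
    (hlev : ∀ s : ℝ, 0 < s → ENNReal.ofReal s * ({κ | s ≤ φ κ}.encard : ℝ≥0∞) ≤ ENNReal.ofReal M)
    {p : ℝ} (hp : 1 < p) (hp2 : p ≤ 2) {f : X → ℂ} (hf : MemLp f (ENNReal.ofReal p) μ) :
    ∑' κ, ENNReal.ofReal (φ κ ^ (2 - p)) * ‖T f κ‖ₑ ^ p ≤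
      ENNReal.ofReal (paleyConst p * M ^ (2 - p)) * ∫⁻ x, ‖f x‖ₑ ^ p ∂μ := by
  -- At p = 2 the weight is trivial and the claim is Bessel's inequality.
  rcases hp2.eq_or_lt with rfl | hp2
  · have h := hT.tsum_sq_le f (by simpa using hf)
    have h1 : (1 : ℝ≥0∞) ≤ ENNReal.ofReal (paleyConst 2) := by
      simpa using one_le_paleyConst hp le_rfl
    simpa using h.trans (le_mul_of_one_le_left zero_le h1)
  have hfi : Integrable f μ := hf.integrable (by simpa using hp.le)
  let _ : MeasurableSpace ι := ⊤
  have h := hT.paley_of_stronglyMeasurable hφ hM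
    (fun s hs => by rw [Measure.count_apply .of_discrete]; exact hlev s hs) hp hp2
    hfi.aestronglyMeasurable.stronglyMeasurable_mk (hfi.congr hfi.aestronglyMeasurable.ae_eq_mk)
  have h1 : ∫⁻ x, ‖hfi.aestronglyMeasurable.mk f x‖ₑ ^ p ∂μ = ∫⁻ x, ‖f x‖ₑ ^ p ∂μ := by
    refine lintegral_congr_ae ?_
    filter_upwards [hfi.aestronglyMeasurable.ae_eq_mk] with x hx
    rw [← hx]
  rw [h1] at h
  convert! h using 6 with κ
  exact hT.congr_ae hfi hfi.aestronglyMeasurable.ae_eq_mk κ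

/-- The inverse rank is an admissible weight with M = 1: the element of the level set with smallest
c has rank at least the size of the set, and at most 1/s. -/
theorem encard_rank_le {ι α : Type*} [Fintype ι] [LinearOrder α] (c : ι → α) (s : ℝ) (hs : 0 < s) :
    ENNReal.ofReal s *
      ({κ | s ≤ ((Finset.univ.filter fun i => c κ ≤ c i).card : ℝ)⁻¹}.encard : ℝ≥0∞) ≤
        ENNReal.ofReal 1 := by
  classical
  set F : Finset ι := Finset.univ.filter fun κ =>
    s ≤ ((Finset.univ.filter fun i => c κ ≤ c i).card : ℝ)⁻¹ with hF
  have hFs : {κ | s ≤ ((Finset.univ.filter fun i => c κ ≤ c i).card : ℝ)⁻¹} = (F : Set ι) := by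
    ext κ
    simp [hF]
  rw [hFs, Set.encard_coe_eq_coe_finsetCard]
  rcases F.eq_empty_or_nonempty with h | h
  · simp [h]
  obtain ⟨κ, hκ, hmin⟩ := F.exists_min_image c h
  have h1 : F.card ≤ (Finset.univ.filter fun i => c κ ≤ c i).card :=
    Finset.card_le_card fun i hi => by simpa using hmin i hi
  have h2 : s ≤ ((Finset.univ.filter fun i => c κ ≤ c i).card : ℝ)⁻¹ := by simpa [hF] using hκ
  have h3 : 0 < F.card := h.card_pos
  have h4 : s * F.card ≤ 1 := by
    have h5 : (0 : ℝ) < (Finset.univ.filter fun i => c κ ≤ c i).card := by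
      exact_mod_cast h3.trans_le h1
    have h6 : (F.card : ℝ) ≤ (Finset.univ.filter fun i => c κ ≤ c i).card := by exact_mod_cast h1
    calc s * F.card ≤ ((Finset.univ.filter fun i => c κ ≤ c i).card : ℝ)⁻¹ *
        (Finset.univ.filter fun i => c κ ≤ c i).card := by gcongr
      _ = 1 := inv_mul_cancel₀ h5.ne'
  have h7 : (((F.card : ℕ∞)) : ℝ≥0∞) = ENNReal.ofReal F.card := by simp
  rw [h7, ← ENNReal.ofReal_mul hs.le]
  exact ENNReal.ofReal_le_ofReal h4

/-- The Hausdorff–Young inequality follows from the Hardy–Littlewood–Paley inequality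
`∑ c κ ^ p * N κ ^ (p - 2) ≤ Y`, where `N κ` is the rank of `c κ` in decreasing order. -/
theorem sum_rpow_le_of_sum_rank_le {ι : Type*} [Fintype ι] (c : ι → ℝ) (hc : ∀ κ, 0 ≤ c κ)
    {p p' Y : ℝ} (hp : 1 < p) (hp2 : p ≤ 2) (hpp' : 1 / p + 1 / p' = 1)
    (hY : ∑ κ, (((Finset.univ.filter fun i => c κ ≤ c i).card : ℝ)⁻¹) ^ (2 - p) * c κ ^ p ≤ Y) :
    ∑ κ, c κ ^ p' ≤ Y ^ (p' / p) := by
  classical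
  set N : ι → ℝ := fun κ => ((Finset.univ.filter fun i => c κ ≤ c i).card : ℝ) with hN
  have hp0 : 0 < p := by linarith
  have hp'0 : p' ≠ 0 := by
    rintro rfl
    simp at hpp'
    linarith
  have hp'eq : p' * (p - 1) = p := by
    field_simp at hpp'
    linarith
  have hp'2 : 2 ≤ p' := by
    have : p' = p / (p - 1) := by
      rw [eq_div_iff (by linarith), hp'eq]
    rw [this, le_div_iff₀ (by linarith)]
    linarith
  have hNpos : ∀ κ, 0 < N κ := fun κ => by
    have : 0 < (Finset.univ.filter fun i => c κ ≤ c i).card := Finset.card_pos.2 ⟨κ, by simp⟩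
    exact Nat.cast_pos.2 this
  have hY0 : 0 ≤ Y := le_trans (Finset.sum_nonneg fun κ _ =>
    mul_nonneg (Real.rpow_nonneg (inv_nonneg.2 (hNpos κ).le) _) (Real.rpow_nonneg (hc κ) _)) hY
  -- The N κ indices with c i ≥ c κ each contribute at least the term of κ, since their rank is no
  -- larger.
  have hweak : ∀ κ, c κ ^ p ≤ Y * (N κ)⁻¹ ^ (p - 1) := by
    intro κ
    have h1 : N κ * ((N κ)⁻¹ ^ (2 - p) * c κ ^ p) ≤ Y := by
      refine le_trans ?_ hY
      rw [hN, ← nsmul_eq_mul, ← Finset.sum_const]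
      refine (Finset.sum_le_sum (f := fun _ => _) (g := fun i => (N i)⁻¹ ^ (2 - p) * c i ^ p)
        ?_).trans (Finset.sum_le_sum_of_subset_of_nonneg (Finset.filter_subset _ _) fun i _ _ =>
          mul_nonneg (Real.rpow_nonneg (inv_nonneg.2 (hNpos i).le) _) (Real.rpow_nonneg (hc i) _))
      intro i hi
      have hi' : c κ ≤ c i := by simpa using hi
      have h2 : N i ≤ N κ := by
        have : (Finset.univ.filter fun k => c i ≤ c k).card ≤
            (Finset.univ.filter fun k => c κ ≤ c k).card :=
          Finset.card_le_card fun k hk => by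
            simp only [Finset.mem_filter, Finset.mem_univ, true_and] at hk ⊢
            exact hi'.trans hk
        exact Nat.cast_le.2 this
      have h3 : (N κ)⁻¹ ≤ (N i)⁻¹ := inv_anti₀ (hNpos i) h2
      have h4 : 0 ≤ (N κ)⁻¹ := inv_nonneg.2 (hNpos κ).le
      exact mul_le_mul (Real.rpow_le_rpow h4 h3 (by linarith))
        (Real.rpow_le_rpow (hc κ) hi' hp0.le) (Real.rpow_nonneg (hc κ) _)
        (Real.rpow_nonneg (h4.trans h3) _)
    have h5 : N κ * (N κ)⁻¹ ^ (2 - p) * (N κ)⁻¹ ^ (p - 1) = 1 := by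
      rw [mul_assoc, ← Real.rpow_add (inv_pos.2 (hNpos κ)), show 2 - p + (p - 1) = 1 by ring,
        Real.rpow_one, mul_inv_cancel₀ (hNpos κ).ne']
    calc c κ ^ p = N κ * ((N κ)⁻¹ ^ (2 - p) * c κ ^ p) * (N κ)⁻¹ ^ (p - 1) := by
          linear_combination (- c κ ^ p) * h5
      _ ≤ _ := mul_le_mul_of_nonneg_right h1 (Real.rpow_nonneg (inv_nonneg.2 (hNpos κ).le) _)
  -- Spend `hweak` on the surplus power p' - p; the exponents match because (p - 1)(p'/p - 1) = 2 -
  -- p.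
  have hpt : ∀ κ, c κ ^ p' ≤ Y ^ (p' / p - 1) * ((N κ)⁻¹ ^ (2 - p) * c κ ^ p) := by
    intro κ
    have hNi := inv_pos.2 (hNpos κ)
    have hexp : 0 ≤ p' / p - 1 := by
      rw [sub_nonneg, le_div_iff₀ hp0]
      linarith
    have h1 : c κ ^ p' = (c κ ^ p) ^ (p' / p - 1) * c κ ^ p := by
      rw [← Real.rpow_mul (hc κ), ← Real.rpow_add_of_nonneg (hc κ) (by positivity) hp0.le]
      congr 1
      field_simp
      ring
    rw [h1, ← mul_assoc]
    refine mul_le_mul_of_nonneg_right ?_ (Real.rpow_nonneg (hc κ) _)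
    refine (Real.rpow_le_rpow (Real.rpow_nonneg (hc κ) _) (hweak κ) hexp).trans_eq ?_
    rw [Real.mul_rpow hY0 (Real.rpow_nonneg hNi.le _), ← Real.rpow_mul hNi.le]
    congr 2
    field_simp
    linarith
  calc ∑ κ, c κ ^ p' ≤ ∑ κ, Y ^ (p' / p - 1) * ((N κ)⁻¹ ^ (2 - p) * c κ ^ p) :=
        Finset.sum_le_sum fun κ _ => hpt κ
    _ ≤ Y ^ (p' / p - 1) * Y := by
        rw [← Finset.mul_sum]
        exact mul_le_mul_of_nonneg_left hY (Real.rpow_nonneg hY0 _)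
    _ = Y ^ (p' / p) := by
        have hpos : 0 < p' / p := by positivity
        conv_lhs => rw [← Real.rpow_one Y]
        rw [← Real.rpow_mul hY0, one_mul]
        conv_lhs => rw [← Real.rpow_add_of_nonneg hY0 (by
          rw [sub_nonneg, le_div_iff₀ hp0]
          linarith) zero_le_one]
        congr 1
        ring

/-- The **Hausdorff–Young inequality**, with a constant. -/
theorem IsBesselMap.hausdorff_young (hT : IsBesselMap μ T) {p p' : ℝ} (hp : 1 < p) (hp2 : p ≤ 2)
    (hpp' : 1 / p + 1 / p' = 1) {f : X → ℂ} (hf : MemLp f (ENNReal.ofReal p) μ) :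
    ∑' κ, ‖T f κ‖ₑ ^ p' ≤
      (ENNReal.ofReal (paleyConst p) * ∫⁻ x, ‖f x‖ₑ ^ p ∂μ) ^ (p' / p) := by
  have hp0 : 0 < p := by linarith
  have hp'0 : 0 < p' := by
    by_contra h
    have h1 : 1 / p' ≤ 0 := one_div_nonpos.2 (not_lt.1 h)
    have h2 : 1 / p < 1 := by rwa [div_lt_one hp0]
    linarith
  have hfin : ∫⁻ x, ‖f x‖ₑ ^ p ∂μ ≠ ∞ := by
    have := lintegral_rpow_enorm_lt_top_of_eLpNorm_lt_top (by simpa using hp0)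
      ENNReal.ofReal_ne_top hf.2
    rw [ENNReal.toReal_ofReal hp0.le] at this
    exact this.ne
  have hYfin : ENNReal.ofReal (paleyConst p) * ∫⁻ x, ‖f x‖ₑ ^ p ∂μ ≠ ∞ :=
    ENNReal.mul_ne_top ENNReal.ofReal_ne_top hfin
  rw [ENNReal.tsum_eq_iSup_sum]
  -- Ranks need a finite index set; the bound obtained does not depend on S.
  refine iSup_le fun S => ?_
  rw [← Finset.sum_coe_sort]
  set c : S → ℝ := fun κ => ‖T f κ‖ with hcdef
  have hNpos : ∀ κ, 0 < ((Finset.univ.filter fun i => c κ ≤ c i).card : ℝ)⁻¹ := fun κ => by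
    have : 0 < (Finset.univ.filter fun i => c κ ≤ c i).card := Finset.card_pos.2 ⟨κ, by simp⟩
    positivity
  have hpal := (hT.comp (ι' := S) Subtype.val_injective).paley hNpos one_pos (encard_rank_le c) hp hp2 hf
  have hterm : ∀ (κ : S) (q : ℝ), 0 ≤ q → ‖T f κ‖ₑ ^ q = ENNReal.ofReal (c κ ^ q) := fun κ q hq => by
    rw [hcdef, ← ofReal_norm, ENNReal.ofReal_rpow_of_nonneg (norm_nonneg _) hq]
  simp_rw [hterm _ p hp0.le, ← ENNReal.ofReal_mul (Real.rpow_nonneg (hNpos _).le _), tsum_fintype] at hpal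
  rw [← ENNReal.ofReal_sum_of_nonneg fun κ _ =>
    mul_nonneg (Real.rpow_nonneg (hNpos κ).le _) (Real.rpow_nonneg (norm_nonneg _) _),
    Real.one_rpow, mul_one, ENNReal.ofReal_le_iff_le_toReal hYfin] at hpal
  have h := sum_rpow_le_of_sum_rank_le c (fun κ => norm_nonneg _) hp hp2 hpp' hpal
  simp_rw [hterm _ p' hp'0.le]
  rw [← ENNReal.ofReal_sum_of_nonneg fun κ _ => Real.rpow_nonneg (norm_nonneg _) _]
  refine (ENNReal.ofReal_le_ofReal h).trans_eq ?_
  rw [← ENNReal.ofReal_rpow_of_nonneg ENNReal.toReal_nonneg (by positivity),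
    ENNReal.ofReal_toReal hYfin]

/-- The **Hausdorff–Young–Paley inequality** for maps satisfying Bessel's inequality. -/
theorem IsBesselMap.hausdorff_young_paley (hT : IsBesselMap μ T) {φ : ι → ℝ}
    (hφ : ∀ κ, 0 < φ κ) {M : ℝ} (hM : 0 < M)
    (hlev : ∀ s : ℝ, 0 < s → ENNReal.ofReal s * ({κ | s ≤ φ κ}.encard : ℝ≥0∞) ≤ ENNReal.ofReal M)
    {p p' b : ℝ} (hp : 1 < p) (hp2 : p ≤ 2) (hpp' : 1 / p + 1 / p' = 1) (hpb : p ≤ b) (hbp' : b ≤ p')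
    {f : X → ℂ} (hf : MemLp f (ENNReal.ofReal p) μ) :
    (∑' κ, ‖T f κ * ((φ κ ^ (1 / b - 1 / p') : ℝ) : ℂ)‖ₑ ^ b) ^ (1 / b) ≤
      ENNReal.ofReal (paleyConst p ^ (1 / p)) * ENNReal.ofReal M ^ (1 / b - 1 / p') *
        eLpNorm f (ENNReal.ofReal p) μ := by
  have hp0 : 0 < p := by linarith
  have hb0 : 0 < b := by linarith
  have hp'0 : 0 < p' := by linarith
  have hK : 0 < paleyConst p := zero_lt_one.trans_le (one_le_paleyConst hp hp2)
  have hp'eq : p' * (p - 1) = p := by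
    field_simp at hpp'
    linarith
  -- Here α is the Hölder weight of the Paley endpoint. If p = p', then b = p' and α = 0 works.
  obtain ⟨α, hα0, hα1, hαb⟩ : ∃ α : ℝ, 0 ≤ α ∧ 0 ≤ 1 - α ∧ b = α * p + (1 - α) * p' := by
    rcases (hpb.trans hbp').eq_or_lt with h | h
    · exact ⟨0, le_rfl, by simp, by linarith⟩
    · refine ⟨(p' - b) / (p' - p), div_nonneg (by linarith) (by linarith), ?_, ?_⟩
      · rw [sub_nonneg, div_le_one (by linarith)]
        linarith
      · have : p' - p ≠ 0 := by linarith
        field_simp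
        ring
  have hα2 : α * (2 - p) = 1 - b / p' := by
    field_simp
    linear_combination hαb - α * hp'eq
  -- The whole power of φ is thus carried by the Paley factor; the Hausdorff–Young factor is
  -- unweighted.
  have hexp : (1 / b - 1 / p') * b = α * (2 - p) := by
    rw [hα2]
    field_simp
  have hexp0 : 0 ≤ 1 / b - 1 / p' := sub_nonneg.2 (one_div_le_one_div_of_le hb0 hbp')
  set Y := ∫⁻ x, ‖f x‖ₑ ^ p ∂μ with hY
  have hterm : ∀ κ, ‖T f κ * ((φ κ ^ (1 / b - 1 / p') : ℝ) : ℂ)‖ₑ ^ b =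
      (ENNReal.ofReal (φ κ ^ (2 - p)) * ‖T f κ‖ₑ ^ p) ^ α * (‖T f κ‖ₑ ^ p') ^ (1 - α) := by
    intro κ
    have h1 : ‖((φ κ ^ (1 / b - 1 / p') : ℝ) : ℂ)‖ₑ = ENNReal.ofReal (φ κ ^ (1 / b - 1 / p')) := by
      rw [← ofReal_norm, Complex.norm_real, Real.norm_of_nonneg (Real.rpow_nonneg (hφ κ).le _)]
    rw [enorm_mul, h1, ENNReal.mul_rpow_of_nonneg _ _ hb0.le, ENNReal.mul_rpow_of_nonneg _ _ hα0,
      ENNReal.ofReal_rpow_of_nonneg (Real.rpow_nonneg (hφ κ).le _) hb0.le,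
      ENNReal.ofReal_rpow_of_nonneg (Real.rpow_nonneg (hφ κ).le _) hα0, ← Real.rpow_mul (hφ κ).le,
      ← Real.rpow_mul (hφ κ).le, hexp, mul_comm (2 - p) α, ← ENNReal.rpow_mul, ← ENNReal.rpow_mul,
      mul_assoc, ← ENNReal.rpow_add_of_nonneg _ _ (by positivity) (by positivity), mul_comm]
    congr 2
    linarith
  let _ : MeasurableSpace ι := ⊤
  have hholder := ENNReal.lintegral_mul_norm_pow_le (μ := (Measure.count : Measure ι))
    (f := fun κ => ENNReal.ofReal (φ κ ^ (2 - p)) * ‖T f κ‖ₑ ^ p) (g := fun κ => ‖T f κ‖ₑ ^ p')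
    Measurable.of_discrete.aemeasurable Measurable.of_discrete.aemeasurable hα0 hα1 (by ring)
  simp_rw [lintegral_count, ← hterm] at hholder
  have hpal := hT.paley hφ hM hlev hp hp2 hf
  have hhy := hT.hausdorff_young hp hp2 hpp' hf
  have hnorm : eLpNorm f (ENNReal.ofReal p) μ = Y ^ (1 / p) := by
    rw [eLpNorm_eq_lintegral_rpow_enorm_toReal (by simpa using hp0) ENNReal.ofReal_ne_top,
      ENNReal.toReal_ofReal hp0.le]
  have hK1 : ENNReal.ofReal (paleyConst p) ≠ 0 := by simpa using hK
  have hM1 : ENNReal.ofReal M ≠ 0 := by simpa using hM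
  calc _ ≤ ((ENNReal.ofReal (paleyConst p * M ^ (2 - p)) * Y) ^ α *
        ((ENNReal.ofReal (paleyConst p) * Y) ^ (p' / p)) ^ (1 - α)) ^ (1 / b) := by
        gcongr
        exact hholder.trans (by gcongr)
    _ = (ENNReal.ofReal M ^ (α * (2 - p)) * (ENNReal.ofReal (paleyConst p) * Y) ^ (b / p)) ^ (1 / b) := by
        congr 1
        rw [ENNReal.ofReal_mul hK.le, mul_right_comm, mul_comm _ (ENNReal.ofReal (M ^ (2 - p))),
          ENNReal.mul_rpow_of_nonneg _ _ hα0, ← ENNReal.ofReal_rpow_of_pos hM, ← ENNReal.rpow_mul,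
          ← ENNReal.rpow_mul, mul_assoc,
          ← ENNReal.rpow_add_of_nonneg _ _ hα0 (by positivity), mul_comm (2 - p)]
        congr 2
        rw [hαb]
        field_simp
    _ = _ := by
        rw [hnorm, ← ENNReal.ofReal_rpow_of_pos hK, ENNReal.mul_rpow_of_nonneg _ _ (by positivity),
          ← ENNReal.rpow_mul, ← ENNReal.rpow_mul, ← hexp, mul_assoc, mul_one_div_cancel hb0.ne',
          mul_one, show b / p * (1 / b) = 1 / p by field_simp,
          ENNReal.mul_rpow_of_nonneg _ _ (by positivity)]
        ring

end Interpolation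

/-! ### Exponentials on a fundamental domain -/

namespace LatticeFourier

variable {d : ℕ} {L : Submodule ℤ (EuclideanSpace ℝ (Fin d))}
  {Ω : Set (EuclideanSpace ℝ (Fin d))}

/-- The exponential `e^{2πi κ·x}`. -/
noncomputable def expChar (κ x : EuclideanSpace ℝ (Fin d)) : ℂ :=
  Complex.exp (2 * Real.pi * Complex.I * ((⟪κ, x⟫_ℝ : ℝ) : ℂ))

theorem expChar_add (κ x y : EuclideanSpace ℝ (Fin d)) :
    expChar κ (x + y) = expChar κ x * expChar κ y := by
  rw [expChar, expChar, expChar, ← Complex.exp_add, inner_add_right]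
  push_cast
  ring_nf

theorem conj_expChar (κ x : EuclideanSpace ℝ (Fin d)) :
    (starRingEnd ℂ) (expChar κ x) =
      Complex.exp (-2 * Real.pi * Complex.I * ((⟪κ, x⟫_ℝ : ℝ) : ℂ)) := by
  rw [expChar, ← Complex.exp_conj]
  simp [map_ofNat]

theorem conj_expChar_mul (κ κ' x : EuclideanSpace ℝ (Fin d)) :
    (starRingEnd ℂ) (expChar κ x) * expChar κ' x = expChar (κ' - κ) x := by
  rw [conj_expChar, expChar, expChar, ← Complex.exp_add, inner_sub_left]
  push_cast
  ring_nf

theorem norm_expChar (κ x : EuclideanSpace ℝ (Fin d)) : ‖expChar κ x‖ = 1 := by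
  rw [expChar, show 2 * (Real.pi : ℂ) * Complex.I * ((⟪κ, x⟫_ℝ : ℝ) : ℂ) =
    ((2 * Real.pi * ⟪κ, x⟫_ℝ : ℝ) : ℂ) * Complex.I by push_cast; ring,
    Complex.norm_exp_ofReal_mul_I]

theorem continuous_expChar (κ : EuclideanSpace ℝ (Fin d)) : Continuous (expChar κ) := by
  unfold expChar
  fun_prop

theorem expChar_of_mem {κ l : EuclideanSpace ℝ (Fin d)} (hκ : κ ∈ dualLattice L) (hl : l ∈ L) :
    expChar κ l = 1 := by
  obtain ⟨n, hn⟩ := mem_dualLattice.1 hκ l hl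
  rw [expChar, ← hn, Complex.exp_eq_one_iff]
  exact ⟨n, by push_cast; ring⟩

theorem exists_expChar_ne_one {κ : EuclideanSpace ℝ (Fin d)} (hκ : κ ≠ 0) :
    ∃ y, expChar κ y ≠ 1 := by
  -- This point has inner product 1/2 with κ, so the character is -1 there.
  refine ⟨(2 * ‖κ‖ ^ 2)⁻¹ • κ, ?_⟩
  have h0 : ‖κ‖ ≠ 0 := norm_ne_zero_iff.2 hκ
  have h : (⟪κ, (2 * ‖κ‖ ^ 2)⁻¹ • κ⟫_ℝ : ℝ) = 1 / 2 := by
    rw [inner_smul_right, real_inner_self_eq_norm_sq]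
    field_simp
  rw [expChar, h, show 2 * (Real.pi : ℂ) * Complex.I * ((1 / 2 : ℝ) : ℂ) = Real.pi * Complex.I by
    push_cast; ring, Complex.exp_pi_mul_I]
  norm_num

theorem IsLatticeFundamentalDomain.isAddFundamentalDomain (hΩ : IsLatticeFundamentalDomain L Ω) :
    IsAddFundamentalDomain L Ω volume :=
  IsAddFundamentalDomain.mk' hΩ.measurable fun x => by
    simpa [Submodule.vadd_def, add_comm] using hΩ.existsUnique_add_mem x

theorem IsLatticeFundamentalDomain.preimage_add_right (hΩ : IsLatticeFundamentalDomain L Ω)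
    (y : EuclideanSpace ℝ (Fin d)) : IsLatticeFundamentalDomain L ((· + y) ⁻¹' Ω) where
  measurable := hΩ.measurable.preimage (measurePreserving_add_right volume y).quasiMeasurePreserving
  existsUnique_add_mem x := by
    simpa [add_right_comm] using hΩ.existsUnique_add_mem (x + y)

variable [DiscreteTopology L] [IsZLattice ℝ L]

theorem IsLatticeFundamentalDomain.setIntegral_eq {Ω' : Set (EuclideanSpace ℝ (Fin d))}
    (hΩ : IsLatticeFundamentalDomain L Ω) (hΩ' : IsLatticeFundamentalDomain L Ω')
    {g : EuclideanSpace ℝ (Fin d) → ℂ} (hg : ∀ l ∈ L, ∀ x, g (l + x) = g x) :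
    ∫ x in Ω, g x = ∫ x in Ω', g x := by
  have : VAddInvariantMeasure L (EuclideanSpace ℝ (Fin d)) volume :=
    inferInstanceAs <| VAddInvariantMeasure L.toAddSubgroup (EuclideanSpace ℝ (Fin d)) volume
  exact hΩ.isAddFundamentalDomain.setIntegral_eq hΩ'.isAddFundamentalDomain fun l x => hg l l.2 x

/-- Translating Ω by y gives another fundamental domain, on which the periodic character has the
same integral; but translation multiplies the integral by `expChar κ y` ≠ 1. -/
theorem IsLatticeFundamentalDomain.setIntegral_expChar_eq_zero
    (hΩ : IsLatticeFundamentalDomain L Ω) {κ : EuclideanSpace ℝ (Fin d)} (hκ : κ ∈ dualLattice L)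
    (h0 : κ ≠ 0) : ∫ x in Ω, expChar κ x = 0 := by
  obtain ⟨y, hy⟩ := exists_expChar_ne_one h0
  have h1 : ∫ x in Ω, expChar κ x = (∫ x in Ω, expChar κ x) * expChar κ y := by
    calc ∫ x in Ω, expChar κ x = ∫ x in (· + y) ⁻¹' Ω, expChar κ (x + y) :=
          ((measurePreserving_add_right volume y).setIntegral_preimage_emb
            (measurableEmbedding_addRight y) _ _).symm
      _ = (∫ x in (· + y) ⁻¹' Ω, expChar κ x) * expChar κ y := by
          simp_rw [expChar_add, integral_mul_const]
      _ = _ := by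
          rw [(hΩ.preimage_add_right y).setIntegral_eq hΩ fun l hl x => by
            rw [expChar_add, expChar_of_mem hκ hl, one_mul]]
  have h2 : (∫ x in Ω, expChar κ x) * (expChar κ y - 1) = 0 := by
    rw [mul_sub, ← h1]
    ring
  exact (mul_eq_zero.1 h2).resolve_right (sub_ne_zero.2 hy)

theorem IsLatticeFundamentalDomain.volume_ne_zero (hΩ : IsLatticeFundamentalDomain L Ω) :
    volume Ω ≠ 0 := by
  have : VAddInvariantMeasure L (EuclideanSpace ℝ (Fin d)) volume :=
    inferInstanceAs <| VAddInvariantMeasure L.toAddSubgroup (EuclideanSpace ℝ (Fin d)) volume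
  exact hΩ.isAddFundamentalDomain.measure_ne_zero (NeZero.ne _)

theorem IsLatticeFundamentalDomain.volume_ne_top (hΩ : IsLatticeFundamentalDomain L Ω) :
    volume Ω ≠ ∞ := by
  have : VAddInvariantMeasure L (EuclideanSpace ℝ (Fin d)) volume :=
    inferInstanceAs <| VAddInvariantMeasure L.toAddSubgroup (EuclideanSpace ℝ (Fin d)) volume
  let b := Module.Free.chooseBasis ℤ L
  rw [hΩ.isAddFundamentalDomain.measure_eq (ZLattice.isAddFundamentalDomain b volume)]
  -- All fundamental domains have equal volume, and the parallelepiped of a ℤ-basis is bounded.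
  exact (ZSpan.fundamentalDomain_isBounded (b.ofZLatticeBasis ℝ)).measure_lt_top.ne

/-- Normalized Lebesgue measure on `Ω`. -/
noncomputable abbrev normalizedMeasure (Ω : Set (EuclideanSpace ℝ (Fin d))) :
    Measure (EuclideanSpace ℝ (Fin d)) :=
  (volume Ω)⁻¹ • volume.restrict Ω

theorem IsLatticeFundamentalDomain.isProbabilityMeasure (hΩ : IsLatticeFundamentalDomain L Ω) :
    IsProbabilityMeasure (normalizedMeasure Ω) :=
  ⟨by simp [ENNReal.inv_mul_cancel hΩ.volume_ne_zero hΩ.volume_ne_top]⟩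

theorem integral_normalizedMeasure (g : EuclideanSpace ℝ (Fin d) → ℂ) :
    ∫ x, g x ∂normalizedMeasure Ω = ((volume.real Ω : ℝ) : ℂ)⁻¹ * ∫ x in Ω, g x := by
  rw [integral_smul_measure, ENNReal.toReal_inv, Complex.real_smul]
  simp [Measure.real]

theorem coeff_eq_integral (f : EuclideanSpace ℝ (Fin d) → ℂ) (κ : EuclideanSpace ℝ (Fin d)) :
    coeff Ω f κ = ∫ x, f x * (starRingEnd ℂ) (expChar κ x) ∂normalizedMeasure Ω := by
  rw [integral_normalizedMeasure, coeff]
  simp_rw [conj_expChar]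

theorem memLp_expChar {μ : Measure (EuclideanSpace ℝ (Fin d))} [IsFiniteMeasure μ]
    (κ : EuclideanSpace ℝ (Fin d)) : MemLp (expChar κ) 2 μ :=
  MemLp.of_bound (continuous_expChar κ).aestronglyMeasurable 1
    (Filter.Eventually.of_forall fun x => (norm_expChar κ x).le)

theorem inner_toLp_expChar {μ : Measure (EuclideanSpace ℝ (Fin d))} [IsFiniteMeasure μ]
    (κ : EuclideanSpace ℝ (Fin d)) {h : EuclideanSpace ℝ (Fin d) → ℂ} (hh : MemLp h 2 μ) :
    ⟪(memLp_expChar (μ := μ) κ).toLp, hh.toLp⟫_ℂ =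
      ∫ x, h x * (starRingEnd ℂ) (expChar κ x) ∂μ := by
  rw [L2.inner_def]
  refine integral_congr_ae ?_
  filter_upwards [(memLp_expChar (μ := μ) κ).coeFn_toLp, hh.coeFn_toLp] with x h1 h2
  rw [h1, h2, RCLike.inner_apply]

theorem IsLatticeFundamentalDomain.orthonormal_expChar (hΩ : IsLatticeFundamentalDomain L Ω)
    [IsFiniteMeasure (normalizedMeasure Ω)] :
    Orthonormal ℂ fun κ : dualLattice L =>
      (memLp_expChar (μ := normalizedMeasure Ω) (κ : EuclideanSpace ℝ (Fin d))).toLp := by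
  classical
  have hvol : (volume.real Ω : ℂ) ≠ 0 := by
    exact_mod_cast (ENNReal.toReal_pos hΩ.volume_ne_zero hΩ.volume_ne_top).ne'
  rw [orthonormal_iff_ite]
  intro κ κ'
  rw [inner_toLp_expChar]
  simp_rw [mul_comm (expChar _ _), conj_expChar_mul]
  rw [integral_normalizedMeasure]
  split_ifs with h
  · simp [h, expChar, hvol]
  · rw [hΩ.setIntegral_expChar_eq_zero ((dualLattice L).sub_mem κ'.2 κ.2), mul_zero]
    exact sub_ne_zero.2 fun h' => h (Subtype.ext h'.symm)

/-- The L¹ bound holds since characters have modulus 1. Orthonormality alone gives Bessel;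
completeness of the characters is not needed. -/
theorem IsLatticeFundamentalDomain.isBesselMap_coeff (hΩ : IsLatticeFundamentalDomain L Ω) :
    IsBesselMap (normalizedMeasure Ω) fun f (κ : dualLattice L) => coeff Ω f κ where
  map_add g h hg hh κ := by
    simp_rw [coeff_eq_integral, Pi.add_apply, add_mul]
    have hint : ∀ g, Integrable g (normalizedMeasure Ω) → Integrable (fun x =>
        g x * (starRingEnd ℂ) (expChar (κ : EuclideanSpace ℝ (Fin d)) x)) (normalizedMeasure Ω) :=
      fun g hg => hg.mul_bdd (c := 1)
        (Complex.continuous_conj.comp (continuous_expChar _)).aestronglyMeasurable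
        (Filter.Eventually.of_forall fun x => by simp [norm_expChar])
    exact integral_add (hint g hg) (hint h hh)
  enorm_le g hg κ := by
    rw [coeff_eq_integral]
    refine (enorm_integral_le_lintegral_enorm _).trans_eq (lintegral_congr fun x => ?_)
    rw [enorm_mul, RCLike.enorm_conj, ← ofReal_norm (expChar _ _), norm_expChar, ENNReal.ofReal_one,
      mul_one]
  tsum_sq_le h hh := by
    have := hΩ.isProbabilityMeasure
    have hc : ∀ κ : dualLattice L, ‖coeff Ω h κ‖ₑ ^ 2 = ENNReal.ofReal
        (‖⟪(memLp_expChar (μ := normalizedMeasure Ω) (κ : EuclideanSpace ℝ (Fin d))).toLp,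
          hh.toLp⟫_ℂ‖ ^ 2) := fun κ => by
      rw [inner_toLp_expChar, ← coeff_eq_integral, ENNReal.ofReal_pow (norm_nonneg _), ofReal_norm]
    simp_rw [hc]
    rw [← ENNReal.ofReal_tsum_of_nonneg (fun _ => by positivity)
      (hΩ.orthonormal_expChar.inner_products_summable _)]
    refine (ENNReal.ofReal_le_ofReal (hΩ.orthonormal_expChar.tsum_inner_products_le _)).trans_eq ?_
    rw [ENNReal.ofReal_pow (norm_nonneg _), Lp.norm_toLp, ENNReal.ofReal_toReal hh.2.ne,
      eLpNorm_eq_lintegral_rpow_enorm_toReal two_ne_zero ENNReal.ofNat_ne_top]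
    rw [← ENNReal.rpow_natCast, ← ENNReal.rpow_mul]
    simp

end LatticeFourier

/-! ### The theorem for lattices -/

theorem mainTheorem3 (p p' b : ℝ) (hp : 1 < p) (hp2 : p ≤ 2) (hpp' : 1 / p + 1 / p' = 1)
    (hpb : p ≤ b) (hbp' : b ≤ p') :
    ∃ C : ℝ≥0, 0 < C ∧
      ∀ (d : ℕ) (L : Submodule ℤ (EuclideanSpace ℝ (Fin d))) [DiscreteTopology L] [IsZLattice ℝ L]
        (Ω : Set (EuclideanSpace ℝ (Fin d))), LatticeFourier.IsLatticeFundamentalDomain L Ω →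
      ∀ φ : LatticeFourier.dualLattice L → ℝ, (∀ κ, 0 < φ κ) → LatticeFourier.levelSup φ < ∞ →
      ∀ f : EuclideanSpace ℝ (Fin d) → ℂ, MemLp f (ENNReal.ofReal p) (volume.restrict Ω) →
        (∑' κ : LatticeFourier.dualLattice L,
            ‖LatticeFourier.coeff Ω f κ * ((φ κ ^ (1 / b - 1 / p') : ℝ) : ℂ)‖ₑ ^ b) ^ (1 / b) ≤
          C * LatticeFourier.levelSup φ ^ (1 / b - 1 / p') * LatticeFourier.normLp Ω p f := by
  have hK : 0 < paleyConst p := zero_lt_one.trans_le (one_le_paleyConst hp hp2)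
  refine ⟨(paleyConst p ^ (1 / p)).toNNReal, Real.toNNReal_pos.2 (Real.rpow_pos_of_pos hK _), ?_⟩
  intro d L _ _ Ω hΩ φ hφ hfin f hf
  have hlev : ∀ s : ℝ, 0 < s → ENNReal.ofReal s * (({κ | s ≤ φ κ}.encard : ℕ∞) : ℝ≥0∞) ≤
      LatticeFourier.levelSup φ := fun s hs =>
    le_iSup₂ (f := fun (s : ℝ) (_ : 0 < s) =>
      ENNReal.ofReal s * (({κ | s ≤ φ κ}.encard : ℕ∞) : ℝ≥0∞)) s hs
  -- The level s = φ 0 > 0 contains κ = 0, so M_φ is positive, as the abstract inequality requires.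
  have hpos : LatticeFourier.levelSup φ ≠ 0 := by
    intro h
    have h1 := hlev (φ 0) (hφ 0)
    rw [h, nonpos_iff_eq_zero, mul_eq_zero] at h1
    rcases h1 with h1 | h1
    · exact (hφ 0).not_ge (ENNReal.ofReal_eq_zero.1 h1)
    · have h2 : {κ | φ 0 ≤ φ κ} = ∅ := by simpa using h1
      exact h2.le (show (0 : LatticeFourier.dualLattice L) ∈ {κ | φ 0 ≤ φ κ} from le_refl (φ 0))
  have := hΩ.isProbabilityMeasure
  have h := hΩ.isBesselMap_coeff.hausdorff_young_paley hφ (ENNReal.toReal_pos hpos hfin.ne)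
    (fun s hs => by rw [ENNReal.ofReal_toReal hfin.ne]; exact hlev s hs) hp hp2 hpp' hpb hbp'
    (hf.smul_measure (ENNReal.inv_ne_top.2 hΩ.volume_ne_zero))
  rwa [ENNReal.ofReal_toReal hfin.ne] at h
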